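/- Let $\mathbb I$ be a set and let $\mathcal I$ be an ideal on $\mathbb I$ (a nonempty family of subsets of $\mathbb I$, closed under subsets and finite unions, with $\mathbb I\notin\mathcal I$). Let $G=\prod_{\mathbb I}\mathfrak S_3/\mathcal I$ be the reduced power of the symmetric group $\mathfrak S_3$, that is, the quotient of $\mathfrak S_3^{\mathbb I}$ identifying $(a_i)$ and $(b_i)$ when $\{i : a_i\neq b_i\}\in\mathcal I$. Let $\mathcal P(\mathbb I)/\mathcal I$ be the quotient Boolean algebra, ordered by $[A]\subseteq[B]$ if and only if $A\setminus B\in\mathcal I$, and for $p\in\{2,3\}$ define $\operatorname{supp}_p\colon G\to\mathcal P(\mathbb I)/\mathcal I$ by $$\operatorname{supp}_p\big([(a_i)_i]_{\mathcal I}\big)=\big[\{i\in\mathbb I : a_i^p=e\}\big]_{\mathcal I}.$$ Consider the two-sorted structure $\mathcal G$ with main sort $(G,\cdot)$, second sort $(\mathcal P(\mathbb I)/\mathcal I,\subseteq)$, and the two functions $\operatorname{supp}_2,\operatorname{supp}_3$ between them; its language is $\mathcal L^\star=\{\cdot,\subseteq,\operatorname{supp}_2,\operatorname{supp}_3\}$.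 Then: 1. $\mathcal G$ is an interpretable expansion of the group $(G,\cdot)$: there are $k\in\mathbb N$, a set $D\subseteq G^k$ and a surjection $\pi\colon D\to\mathcal P(\mathbb I)/\mathcal I$ such that $D$ and the relations $\pi(d)=\pi(d')$, $\pi(d)\subseteq\pi(d')$, $\operatorname{supp}_2(g)=\pi(d)$ and $\operatorname{supp}_3(g)=\pi(d)$ (for $g\in G$ and $d,d'\in D$) are definable without parameters in $(G,\cdot)$. 2. $\mathcal G$ eliminates quantifiers relative to $(\mathcal P(\mathbb I)/\mathcal I,\subseteq)$: every $\mathcal L^\star$-formula $\varphi(\bar x,\bar Y)$, with $\bar x$ variables of the main sort and $\bar Y$ variables of the second sort, is equivalent in $\mathcal G$ to a Boolean combination, in the same free variables, of atomic $\mathcal L^\star$-formulas and of formulas $\psi(s_1,\dots,s_r)$, where $\psi$ is a first-order formula (possibly with quantifiers) of $(\mathcal P(\mathbb I)/\mathcal I,\subseteq)$ and $s_1,\dots,s_r$ are $\mathcal L^\star$-terms of the second sort. -/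

import Mathlib

universe u v

/-! ### Reduced powers and the quotient Boolean algebra -/

/-- The congruence `a ≃ b ↔ {i | a i ≠ b i} ∈ 𝓘` on the full power `ι → M`. -/
def reducedPowerCon {ι : Type u} (𝓘 : Order.Ideal (Set ι)) (M : Type v) [Mul M] :
    Con (ι → M) where
  r a b := {i | a i ≠ b i} ∈ 𝓘
  iseqv :=
    { refl := fun a => by
        have h : {i | a i ≠ a i} = (∅ : Set ι) := by ext i; simp
        rw [h]; exact 𝓘.bot_mem
      symm := fun {a b} hab => by
        have h : {i | b i ≠ a i} = {i | a i ≠ b i} := by ext i; exact ne_comm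
        rw [h]; exact hab
      trans := fun {a b c} hab hbc => by
        refine 𝓘.lower ?_ (Order.Ideal.sup_mem hab hbc)
        intro i hi
        by_cases h : a i = b i
        · exact Or.inr (fun h' => hi (h.trans h'))
        · exact Or.inl h }
  mul' := fun {a b c d} hab hcd => by
    refine 𝓘.lower ?_ (Order.Ideal.sup_mem hab hcd)
    intro i hi
    by_cases h : a i = b i
    · refine Or.inr (fun h' => hi ?_)
      simp only [Pi.mul_apply]
      rw [h, h']
    · exact Or.inl h

/-- The reduced power `∏_ι M / 𝓘`, with the multiplication induced by the coordinatewise one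
(a group when `M` is a group). -/
abbrev ReducedPower {ι : Type u} (𝓘 : Order.Ideal (Set ι)) (M : Type v) [Mul M] :
    Type (max u v) :=
  (reducedPowerCon 𝓘 M).Quotient

/-- The equivalence `A ≃ B ↔ A ∆ B ∈ 𝓘` on subsets of `ι`. -/
def powersetSetoid {ι : Type u} (𝓘 : Order.Ideal (Set ι)) : Setoid (Set ι) where
  r A B := symmDiff A B ∈ 𝓘
  iseqv :=
    { refl := fun A => by rw [symmDiff_self]; exact 𝓘.bot_mem
      symm := fun {A B} h => by rw [symmDiff_comm]; exact h
      trans := fun {A B C} hab hbc =>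
        𝓘.lower (symmDiff_triangle A B C) (Order.Ideal.sup_mem hab hbc) }

/-- The quotient Boolean algebra `𝒫(ι) / 𝓘` (only its order is used). -/
def PowersetQuotient {ι : Type u} (𝓘 : Order.Ideal (Set ι)) : Type u :=
  Quotient (powersetSetoid 𝓘)

/-- The class `[A]_𝓘` of a subset `A` of `ι`. -/
def PowersetQuotient.mk {ι : Type u} (𝓘 : Order.Ideal (Set ι)) (A : Set ι) :
    PowersetQuotient 𝓘 :=
  Quotient.mk (powersetSetoid 𝓘) A

theorem diff_mem_ideal_of_symmDiff {ι : Type u} (𝓘 : Order.Ideal (Set ι)) {A A' B B' : Set ι}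
    (hA : symmDiff A A' ∈ 𝓘) (hB : symmDiff B B' ∈ 𝓘) (h : A \ B ∈ 𝓘) : A' \ B' ∈ 𝓘 := by
  refine 𝓘.lower ?_ (Order.Ideal.sup_mem (Order.Ideal.sup_mem hA hB) h)
  intro i hi
  by_cases h1 : i ∈ A
  · by_cases h2 : i ∈ B
    · exact Or.inl (Or.inr (Or.inl ⟨h2, hi.2⟩))
    · exact Or.inr ⟨h1, h2⟩
  · exact Or.inl (Or.inl (Or.inr ⟨hi.1, h1⟩))

/-- The order of `𝒫(ι) / 𝓘`: `[A] ⊆ [B]` iff `A \ B ∈ 𝓘`. -/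
instance {ι : Type u} (𝓘 : Order.Ideal (Set ι)) : LE (PowersetQuotient 𝓘) where
  le := Quotient.lift₂ (s₁ := powersetSetoid 𝓘) (s₂ := powersetSetoid 𝓘)
    (fun A B => A \ B ∈ 𝓘) (fun _ _ _ _ hA hB => propext
      ⟨diff_mem_ideal_of_symmDiff 𝓘 hA hB,
       diff_mem_ideal_of_symmDiff 𝓘 ((powersetSetoid 𝓘).symm hA) ((powersetSetoid 𝓘).symm hB)⟩)

/-- The support function of the formula `x ^ p = e`, that is
`[(a i)]_𝓘 ↦ [{i | (a i) ^ p = e}]_𝓘`. -/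
def powSupport {ι : Type u} (𝓘 : Order.Ideal (Set ι)) {M : Type v} [Group M] (p : ℕ) :
    ReducedPower 𝓘 M → PowersetQuotient 𝓘 :=
  Quotient.lift (s := (reducedPowerCon 𝓘 M).toSetoid)
    (fun a => PowersetQuotient.mk 𝓘 {i | a i ^ p = 1})
    (fun a b hab => Quotient.sound (s := powersetSetoid 𝓘) (by
      refine 𝓘.lower ?_ hab
      intro i hi h
      rcases hi with ⟨h1, h2⟩ | ⟨h1, h2⟩
      · exact h2 (by simpa [h] using h1)
      · exact h2 (by simpa [h] using h1)))

/-! ### The two-sorted language with symbols `·`, `⊆`, `supp₂`, `supp₃` -/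

/-- Structures for the two-sorted language with a main sort `G` carrying a binary operation `·`,
a second sort `P` carrying a binary relation `⊆`, and two unary functions
`supp₂, supp₃ : G → P`. -/
structure StarStructure where
  G : Type u
  P : Type v
  mul : G → G → G
  le : P → P → Prop
  supp₂ : G → P
  supp₃ : G → P

/-- Terms of the main sort in `m` variables of the main sort. -/
inductive MainTerm (m : ℕ) : Type
  | var : Fin m → MainTerm m
  | mul : MainTerm m → MainTerm m → MainTerm m

/-- Terms of the sort `P` in `m` variables of the main sort and `n` variables of the sort `P`. -/
inductive AlgTerm (m n : ℕ) : Type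
  | var : Fin n → AlgTerm m n
  | supp₂ : MainTerm m → AlgTerm m n
  | supp₃ : MainTerm m → AlgTerm m n

/-- First-order formulas of the two-sorted language whose free variables are among `m` variables
of the main sort and `n` variables of the sort `P`. The connectives `⊥`, `→` and the two universal
quantifiers generate all the others classically. -/
inductive StarFormula : ℕ → ℕ → Type
  | eqMain {m n : ℕ} : MainTerm m → MainTerm m → StarFormula m n
  | eqAlg {m n : ℕ} : AlgTerm m n → AlgTerm m n → StarFormula m n
  | le {m n : ℕ} : AlgTerm m n → AlgTerm m n → StarFormula m n
  | falsum {m n : ℕ} : StarFormula m n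
  | imp {m n : ℕ} : StarFormula m n → StarFormula m n → StarFormula m n
  | allMain {m n : ℕ} : StarFormula (m + 1) n → StarFormula m n
  | allAlg {m n : ℕ} : StarFormula m (n + 1) → StarFormula m n

/-- The value of a term of the main sort. -/
def MainTerm.eval (S : StarStructure.{u, v}) {m : ℕ} (x : Fin m → S.G) : MainTerm m → S.G
  | .var i => x i
  | .mul s t => S.mul (s.eval S x) (t.eval S x)

/-- The value of a term of the sort `P`. -/
def AlgTerm.eval (S : StarStructure.{u, v}) {m n : ℕ} (x : Fin m → S.G) (y : Fin n → S.P) :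
    AlgTerm m n → S.P
  | .var j => y j
  | .supp₂ t => S.supp₂ (t.eval S x)
  | .supp₃ t => S.supp₃ (t.eval S x)

/-- Tarskian satisfaction `S ⊨ φ(x, y)`. -/
def StarFormula.Realize (S : StarStructure.{u, v}) : {m n : ℕ} → StarFormula m n →
    (Fin m → S.G) → (Fin n → S.P) → Prop
  | _, _, .eqMain s t, x, _ => s.eval S x = t.eval S x
  | _, _, .eqAlg s t, x, y => s.eval S x y = t.eval S x y
  | _, _, .le s t, x, y => S.le (s.eval S x y) (t.eval S x y)
  | _, _, .falsum, _, _ => False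
  | _, _, .imp φ ψ, x, y => φ.Realize S x y → ψ.Realize S x y
  | _, _, .allMain φ, x, y => ∀ g : S.G, φ.Realize S (Fin.snoc x g) y
  | _, _, .allAlg φ, x, y => ∀ A : S.P, φ.Realize S x (Fin.snoc y A)

/-- The formulas `ψ(s₁, …, s_k)` where `ψ` is an arbitrary first-order formula of `(P, ⊆)` (with
quantifiers over `P` allowed) and `s₁, …, s_k` are terms of the sort `P`. -/
def StarFormula.IsAlgFormula : {m n : ℕ} → StarFormula m n → Prop
  | _, _, .eqMain _ _ => False
  | _, _, .eqAlg _ _ => True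
  | _, _, .le _ _ => True
  | _, _, .falsum => True
  | _, _, .imp φ ψ => φ.IsAlgFormula ∧ ψ.IsAlgFormula
  | _, _, .allMain _ => False
  | _, _, .allAlg φ => φ.IsAlgFormula

/-- Formulas that are quantifier-free relative to the sort `P`: Boolean combinations of atomic
formulas and of formulas `ψ(s₁, …, s_k)`, with `ψ` an arbitrary first-order formula of `(P, ⊆)` and
`s₁, …, s_k` terms of the sort `P`. -/
inductive StarFormula.IsRelQF : {m n : ℕ} → StarFormula m n → Prop
  | eqMain {m n : ℕ} (s t : MainTerm m) : IsRelQF (.eqMain s t : StarFormula m n)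
  | alg {m n : ℕ} {φ : StarFormula m n} : φ.IsAlgFormula → IsRelQF φ
  | imp {m n : ℕ} {φ ψ : StarFormula m n} : IsRelQF φ → IsRelQF ψ → IsRelQF (.imp φ ψ)

/-- `S` eliminates quantifiers relative to the sort `P`: modulo the (complete) theory of `S`, every
formula is equivalent to one, in the same free variables, that is quantifier-free relative
to `P`. -/
def StarStructure.EliminatesQuantifiersRelAlg (S : StarStructure.{u, v}) : Prop :=
  ∀ (m n : ℕ) (φ : StarFormula m n), ∃ ψ : StarFormula m n, ψ.IsRelQF ∧
    ∀ (x : Fin m → S.G) (y : Fin n → S.P), φ.Realize S x y ↔ ψ.Realize S x y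

/-! ### Interpretability in the reduct to the main sort -/

/-- The function symbols of the one-sorted language with one binary operation `·`. -/
inductive MulFunctions : ℕ → Type
  | mul : MulFunctions 2

/-- The one-sorted first-order language with one binary operation `·`. -/
def mulLanguage : FirstOrder.Language.{0, 0} := ⟨MulFunctions, fun _ => Empty⟩

/-- The reduct `(G, ·)` of a two-sorted structure. -/
instance (S : StarStructure.{u, v}) : mulLanguage.Structure S.G where
  funMap
    | .mul, w => S.mul (w 0) (w 1)
  RelMap := fun r _ => nomatch r

/-- The two-sorted structure `S` is an interpretable expansion of its reduct `(G, ·)`: there are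
`k`, a set `D ⊆ G ^ k` and a surjection `π : D → P` such that `D`, the kernel of `π` (so that `P` is
identified with the quotient of `D` by it), the relation induced by `⊆` on `D`, and the relations
`supp₂ g = π d` and `supp₃ g = π d` are all definable without parameters in `(G, ·)`. The main sort
is interpreted by itself. -/
def StarStructure.IsInterpretableExpansion (S : StarStructure.{u, v}) : Prop :=
  ∃ (k : ℕ) (D : Set (Fin k → S.G)) (π : D → S.P),
    Function.Surjective π ∧
    (∅ : Set S.G).Definable mulLanguage D ∧
    (∅ : Set S.G).Definable mulLanguage
      {w : Fin k ⊕ Fin k → S.G | ∃ (hd : w ∘ Sum.inl ∈ D) (hd' : w ∘ Sum.inr ∈ D),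
        π ⟨w ∘ Sum.inl, hd⟩ = π ⟨w ∘ Sum.inr, hd'⟩} ∧
    (∅ : Set S.G).Definable mulLanguage
      {w : Fin k ⊕ Fin k → S.G | ∃ (hd : w ∘ Sum.inl ∈ D) (hd' : w ∘ Sum.inr ∈ D),
        S.le (π ⟨w ∘ Sum.inl, hd⟩) (π ⟨w ∘ Sum.inr, hd'⟩)} ∧
    (∅ : Set S.G).Definable mulLanguage
      {w : Unit ⊕ Fin k → S.G | ∃ hd : w ∘ Sum.inr ∈ D,
        S.supp₂ (w (Sum.inl ())) = π ⟨w ∘ Sum.inr, hd⟩} ∧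
    (∅ : Set S.G).Definable mulLanguage
      {w : Unit ⊕ Fin k → S.G | ∃ hd : w ∘ Sum.inr ∈ D,
        S.supp₃ (w (Sum.inl ())) = π ⟨w ∘ Sum.inr, hd⟩}

/-! ### Reduced powers of the symmetric group on three letters -/

/-- The reduced power `G = ∏_ι 𝔖₃ / 𝓘` with the sort `(𝒫(ι) / 𝓘, ⊆)` and the support functions of
the formulas `x ^ 2 = e` and `x ^ 3 = e`. -/
def symThreeReducedPower {ι : Type u} (𝓘 : Order.Ideal (Set ι)) : StarStructure.{u, u} where
  G := ReducedPower 𝓘 (Equiv.Perm (Fin 3))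
  P := PowersetQuotient 𝓘
  mul := fun a b => a * b
  le := fun A B => A ≤ B
  supp₂ := powSupport 𝓘 2
  supp₃ := powSupport 𝓘 3

-- Interpretation. Represent an element of the Boolean algebra by a class `d` with `d ^ 3 = 1`,
-- namely by `supp₂ d`, which is the set where `d` is trivial. Coordinatewise the centralizer of `d`
-- is all of 𝔖₃ where `d` is trivial and the alternating group 𝔄₃ elsewhere, so inclusion of
-- supports is inclusion of centralizers (`centralizerLE_iff`). Squaring sends `g` into the
-- cube-trivial elements without changing `supp₂`. For `supp₃`, a transposition inverts every
-- element of 𝔄₃ while elements of 𝔄₃ commute; hence `d * g * d = g` means `supp₃ g ⊆ supp₂ d`, and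
-- `supp₃ g` is the least such support (`isMaxInverted_iff`).
--
-- Elimination. This is a Feferman–Vaught argument. The orbits of 𝔖₃ on `m`-tuples under conjugation
-- are finitely many, and a tuple of the reduced power yields a partition of unity recording where
-- each orbit occurs. Truth of a formula depends on this partition in a first-order way
-- (`exists_definable_typeValue`): a main-sort quantifier becomes a quantifier over partitions
-- indexed by orbits of `(m + 1)`-tuples which refine the given one, since such a refinement can be
-- realized coordinate by coordinate.
--
-- The partition itself is recovered from supports of words, because the orbit of a tuple in 𝔖₃ is
-- determined by which words have order dividing 2 and which have order dividing 3
-- (`tupleType_eq_of_value_pow`). Finitely many words separate all orbits, and their supports pin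
-- down the partition.

universe w

open Filter

/-! ### First-order definable relations -/

section Definability

variable {L : FirstOrder.Language.{0, 0}} {M : Type v} [L.Structure M] {α : Type w}

/-- The relation `R` on `M ^ α` is defined by a first-order formula without parameters. -/
def FODefinable (L : FirstOrder.Language.{0, 0}) {M : Type v} [L.Structure M] {α : Type w}
    (R : (α → M) → Prop) : Prop :=
  ∃ φ : L.Formula α, ∀ v, φ.Realize v ↔ R v

/-- The function `f` from `M ^ α` to `M` is given by a term. -/
def IsTermFun (L : FirstOrder.Language.{0, 0}) {M : Type v} [L.Structure M] {α : Type w}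
    (f : (α → M) → M) : Prop :=
  ∃ t : L.Term α, ∀ v, t.realize v = f v

theorem IsTermFun.var (a : α) : IsTermFun L (fun v : α → M => v a) :=
  ⟨.var a, fun _ => rfl⟩

namespace FODefinable

theorem definable {R : (α → M) → Prop} (h : FODefinable L R) :
    (∅ : Set M).Definable L {v | R v} := by
  obtain ⟨φ, hφ⟩ := h
  exact Set.empty_definable_iff.2 ⟨φ, by ext v; exact (hφ v).symm⟩

theorem congr {R Q : (α → M) → Prop} (h : FODefinable L R) (e : ∀ v, R v ↔ Q v) :
    FODefinable L Q := by
  obtain ⟨φ, hφ⟩ := h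
  exact ⟨φ, fun v => (hφ v).trans (e v)⟩

theorem eq {f g : (α → M) → M} (hf : IsTermFun L f) (hg : IsTermFun L g) :
    FODefinable L (fun v => f v = g v) := by
  obtain ⟨s, hs⟩ := hf
  obtain ⟨t, ht⟩ := hg
  exact ⟨s.equal t, fun v => by rw [FirstOrder.Language.Formula.realize_equal, hs, ht]⟩

theorem falsum : FODefinable L (fun _ : α → M => False) :=
  ⟨⊥, fun _ => FirstOrder.Language.Formula.realize_bot⟩

theorem imp {R Q : (α → M) → Prop} (hR : FODefinable L R) (hQ : FODefinable L Q) :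
    FODefinable L (fun v => R v → Q v) := by
  obtain ⟨φ, hφ⟩ := hR
  obtain ⟨ψ, hψ⟩ := hQ
  exact ⟨φ.imp ψ, fun v => by rw [FirstOrder.Language.Formula.realize_imp, hφ, hψ]⟩

theorem and {R Q : (α → M) → Prop} (hR : FODefinable L R) (hQ : FODefinable L Q) :
    FODefinable L (fun v => R v ∧ Q v) :=
  ((hR.imp (hQ.imp falsum)).imp falsum).congr fun v => by tauto

/-- Conditions that do not depend on the variables are definable. -/
theorem const (p : Prop) : FODefinable L (fun _ : α → M => p) := by
  by_cases hp : p
  · exact (falsum.imp falsum).congr fun _ => by simp [hp]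
  · exact falsum.congr fun _ => by simp [hp]

theorem comp {β : Type*} {R : (α → M) → Prop} (hR : FODefinable L R) (e : α → β) :
    FODefinable L (fun v : β → M => R (v ∘ e)) := by
  obtain ⟨φ, hφ⟩ := hR
  exact ⟨φ.relabel e, fun v => by rw [FirstOrder.Language.Formula.realize_relabel, hφ]⟩

theorem forall_index {κ : Type*} [Finite κ] {R : κ → (α → M) → Prop}
    (hR : ∀ c, FODefinable L (R c)) : FODefinable L (fun v => ∀ c, R c v) := by
  choose φ hφ using hR
  refine ⟨FirstOrder.Language.BoundedFormula.iInf φ, fun v => ?_⟩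
  rw [FirstOrder.Language.Formula.Realize, FirstOrder.Language.BoundedFormula.realize_iInf]
  exact forall_congr' fun c => hφ c v

theorem forall_fun {γ : Type*} [Finite γ] {R : (α → M) → (γ → M) → Prop}
    (hR : FODefinable L (fun w : α ⊕ γ → M => R (w ∘ Sum.inl) (w ∘ Sum.inr))) :
    FODefinable L (fun v => ∀ z : γ → M, R v z) := by
  obtain ⟨φ, hφ⟩ := hR
  refine ⟨φ.iAlls γ, fun v => ?_⟩
  rw [FirstOrder.Language.Formula.realize_iAlls]
  exact forall_congr' fun z => hφ (Sum.elim v z)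

theorem forall_elem {R : (α → M) → M → Prop}
    (hR : FODefinable L (fun w : α ⊕ Unit → M => R (w ∘ Sum.inl) (w (Sum.inr ())))) :
    FODefinable L (fun v => ∀ z : M, R v z) :=
  (forall_fun (R := fun v z => R v (z ())) hR).congr fun _ =>
    ⟨fun h z => h fun _ => z, fun h z => h (z ())⟩

end FODefinable

theorem IsTermFun.mul {S : StarStructure.{u, v}} {f g : (α → S.G) → S.G}
    (hf : IsTermFun mulLanguage f) (hg : IsTermFun mulLanguage g) :
    IsTermFun mulLanguage (fun v => S.mul (f v) (g v)) := by
  obtain ⟨s, hs⟩ := hf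
  obtain ⟨t, ht⟩ := hg
  refine ⟨.func (L := mulLanguage) MulFunctions.mul ![s, t], fun v => ?_⟩
  change _ = S.mul (f v) (g v)
  rw [← hs, ← ht]
  rfl

end Definability

/-! ### Formulas of the second sort -/

section AlgFormulas

/-- The second sort of a two-sorted structure, as a structure in the language of orders. -/
instance StarStructure.algStructure (S : StarStructure.{u, v}) :
    FirstOrder.Language.order.Structure S.P where
  funMap := fun f _ => isEmptyElim f
  RelMap
    | .le, w => S.le (w 0) (w 1)

theorem FODefinable.le {S : StarStructure.{u, v}} {α : Type w} (a b : α) :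
    FODefinable FirstOrder.Language.order (fun v : α → S.P => S.le (v a) (v b)) :=
  ⟨FirstOrder.Language.Relations.formula₂ (L := FirstOrder.Language.order) .le (.var a) (.var b), fun _ =>
    FirstOrder.Language.Formula.realize_rel⟩

/-- Weakening of the variables of the second sort. -/
def AlgTerm.castAdd {m n : ℕ} (k : ℕ) : AlgTerm m n → AlgTerm m (n + k)
  | .var j => .var (Fin.castAdd k j)
  | .supp₂ t => .supp₂ t
  | .supp₃ t => .supp₃ t

theorem AlgTerm.eval_castAdd (S : StarStructure.{u, v}) {m n k : ℕ} (τ : AlgTerm m n)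
    (x : Fin m → S.G) (y : Fin n → S.P) (z : Fin k → S.P) :
    (τ.castAdd k).eval S x (Fin.append y z) = τ.eval S x y := by
  cases τ <;> simp [AlgTerm.castAdd, AlgTerm.eval]

theorem exists_algTerm_eval_eq (S : StarStructure.{u, v}) {α : Type w} {m n k : ℕ}
    (σ : α → AlgTerm m n) (t : FirstOrder.Language.order.Term (α ⊕ Fin k)) :
    ∃ τ : AlgTerm m (n + k), ∀ (x : Fin m → S.G) (y : Fin n → S.P) (z : Fin k → S.P),
      τ.eval S x (Fin.append y z) = t.realize (Sum.elim (fun a => (σ a).eval S x y) z) := by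
  rcases t with ⟨a | j⟩ | f
  · exact ⟨(σ a).castAdd k, fun x y z => AlgTerm.eval_castAdd S _ x y z⟩
  · exact ⟨.var (Fin.natAdd n j), fun x y z => by simp [AlgTerm.eval]⟩
  · exact isEmptyElim f

/-- A formula of `(P, ⊆)` evaluated at terms of the sort `P`. -/
theorem exists_isAlgFormula_of_boundedFormula (S : StarStructure.{u, v}) {α : Type w} {m n k : ℕ}
    (σ : α → AlgTerm m n) (φ : FirstOrder.Language.order.BoundedFormula α k) :
    ∃ ψ : StarFormula m (n + k), ψ.IsAlgFormula ∧
      ∀ (x : Fin m → S.G) (y : Fin n → S.P) (z : Fin k → S.P),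
        ψ.Realize S x (Fin.append y z) ↔ φ.Realize (fun a => (σ a).eval S x y) z := by
  induction φ with
  | falsum => exact ⟨.falsum, trivial, fun _ _ _ => Iff.rfl⟩
  | equal s t =>
    obtain ⟨s', hs⟩ := exists_algTerm_eval_eq S σ s
    obtain ⟨t', ht⟩ := exists_algTerm_eval_eq S σ t
    refine ⟨.eqAlg s' t', trivial, fun x y z => ?_⟩
    rw [StarFormula.Realize, hs, ht]
    rfl
  | rel R ts =>
    cases R
    obtain ⟨s', hs⟩ := exists_algTerm_eval_eq S σ (ts 0)
    obtain ⟨t', ht⟩ := exists_algTerm_eval_eq S σ (ts 1)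
    refine ⟨.le s' t', trivial, fun x y z => ?_⟩
    rw [StarFormula.Realize, hs, ht]
    rfl
  | imp _ _ ih₁ ih₂ =>
    obtain ⟨ψ₁, h₁, h₁'⟩ := ih₁
    obtain ⟨ψ₂, h₂, h₂'⟩ := ih₂
    refine ⟨.imp ψ₁ ψ₂, ⟨h₁, h₂⟩, fun x y z => ?_⟩
    rw [StarFormula.Realize, h₁', h₂']
    rfl
  | all _ ih =>
    obtain ⟨ψ, h, h'⟩ := ih
    refine ⟨.allAlg ψ, h, fun x y z => ?_⟩
    rw [StarFormula.Realize, FirstOrder.Language.BoundedFormula.realize_all]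
    refine forall_congr' fun A => ?_
    rw [← h', Fin.append_snoc]

/-- Bridge from semantic definability over arbitrary index types, where finite conjunctions and
relabelling are available, back to the two-sorted syntax. -/
theorem FODefinable.exists_isAlgFormula {S : StarStructure.{u, v}} {α : Type w} {m n : ℕ}
    {R : (α → S.P) → Prop} (hR : FODefinable FirstOrder.Language.order R) (σ : α → AlgTerm m n) :
    ∃ ψ : StarFormula m n, ψ.IsAlgFormula ∧ ∀ (x : Fin m → S.G) (y : Fin n → S.P),
      ψ.Realize S x y ↔ R (fun a => (σ a).eval S x y) := by
  obtain ⟨φ, hφ⟩ := hR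
  obtain ⟨ψ, h, h'⟩ := exists_isAlgFormula_of_boundedFormula S σ φ
  refine ⟨ψ, h, fun x y => ?_⟩
  rw [← hφ, FirstOrder.Language.Formula.Realize, ← h', Subsingleton.elim default Fin.elim0, Fin.append_elim0]
  rfl

end AlgFormulas

/-! ### Joins and partitions in the second sort -/

section Joins

variable (S : StarStructure.{u, v})

/-- Disjointness for the order of the second sort. -/
def StarStructure.Disj (p q : S.P) : Prop :=
  ∀ r, S.le r p → S.le r q → ∀ s, S.le r s

/-- If `Z` is a partition of unity, then `q` is the join of the `Z c` for which `T c` holds. -/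
def StarStructure.IsJoin {κ : Type w} (Z : κ → S.P) (T : κ → Prop) (q : S.P) : Prop :=
  ∀ c, (T c → S.le (Z c) q) ∧ (¬T c → S.Disj (Z c) q)

/-- The elements `Z c` are pairwise disjoint and have no upper bound but the top element. -/
def StarStructure.IsPartition {κ : Type w} (Z : κ → S.P) : Prop :=
  (∀ c d, c ≠ d → S.Disj (Z c) (Z d)) ∧ ∀ p, (∀ c, S.le (Z c) p) → ∀ s, S.le s p

variable {S} {α : Type*}

theorem FODefinable.disj (a b : α) :
    FODefinable FirstOrder.Language.order (fun v : α → S.P => S.Disj (v a) (v b)) :=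
  forall_elem ((FODefinable.le (Sum.inr ()) (Sum.inl a)).imp
    ((FODefinable.le (Sum.inr ()) (Sum.inl b)).imp
      (forall_elem (FODefinable.le (Sum.inl (Sum.inr ())) (Sum.inr ())))))

theorem FODefinable.isJoin {κ : Type*} [Finite κ] (e : κ → α) (T : κ → Prop) (a : α) :
    FODefinable FirstOrder.Language.order (fun v : α → S.P => S.IsJoin (fun c => v (e c)) T (v a)) :=
  forall_index fun c => ((const (T c)).imp (FODefinable.le (e c) a)).and
    ((const (¬T c)).imp (FODefinable.disj (e c) a))

theorem FODefinable.isPartition {κ : Type*} [Finite κ] (e : κ → α) :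
    FODefinable FirstOrder.Language.order (fun v : α → S.P => S.IsPartition (fun c => v (e c))) :=
  (forall_index fun c => forall_index fun d =>
    (const (c ≠ d)).imp (FODefinable.disj (e c) (e d))).and
  (forall_elem ((forall_index fun c => FODefinable.le (Sum.inl (e c)) (Sum.inr ())).imp
    (forall_elem (FODefinable.le (Sum.inr ()) (Sum.inl (Sum.inr ()))))))

end Joins

/-! ### The reduced power in terms of the dual filter -/

section DualFilter

variable {ι : Type u} (𝓘 : Order.Ideal (Set ι))

/-- The filter of the sets whose complement lies in the ideal. -/
def dualFilter : Filter ι where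
  sets := {A | Aᶜ ∈ 𝓘}
  univ_sets := by
    change (Set.univ : Set ι)ᶜ ∈ 𝓘
    rw [Set.compl_univ]
    exact 𝓘.bot_mem
  sets_of_superset := fun {A B} hA hAB => 𝓘.lower (Set.compl_subset_compl.2 hAB) hA
  inter_sets := fun {A B} hA hB => by
    change (A ∩ B)ᶜ ∈ 𝓘
    rw [Set.compl_inter]
    exact Order.Ideal.sup_mem hA hB

/-- The class of a family in the main sort. -/
def mainClass (a : ι → Equiv.Perm (Fin 3)) : (symThreeReducedPower 𝓘).G :=
  ((a : ι → Equiv.Perm (Fin 3)) : ReducedPower 𝓘 (Equiv.Perm (Fin 3)))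

/-- The class of a set, given by its indicator, in the second sort. -/
def algClass (p : ι → Prop) : (symThreeReducedPower 𝓘).P :=
  PowersetQuotient.mk 𝓘 {i | p i}

theorem mainClass_surjective : Function.Surjective (mainClass 𝓘) :=
  Quotient.mk_surjective

theorem algClass_surjective : Function.Surjective (algClass 𝓘) := fun q => by
  obtain ⟨A, rfl⟩ := Quotient.mk_surjective q
  exact ⟨fun i => i ∈ A, rfl⟩

variable {𝓘}

theorem mainClass_eq_iff {a b : ι → Equiv.Perm (Fin 3)} :
    mainClass 𝓘 a = mainClass 𝓘 b ↔ ∀ᶠ i in dualFilter 𝓘, a i = b i :=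
  (reducedPowerCon 𝓘 (Equiv.Perm (Fin 3))).eq

theorem algClass_le_iff {p q : ι → Prop} :
    (symThreeReducedPower 𝓘).le (algClass 𝓘 p) (algClass 𝓘 q) ↔
      ∀ᶠ i in dualFilter 𝓘, p i → q i := by
  change {i | p i} \ {i | q i} ∈ 𝓘 ↔ {i | p i → q i}ᶜ ∈ 𝓘
  have : {i | p i} \ {i | q i} = {i | p i → q i}ᶜ := by ext i; simp
  rw [this]

theorem algClass_eq_iff {p q : ι → Prop} :
    algClass 𝓘 p = algClass 𝓘 q ↔ ∀ᶠ i in dualFilter 𝓘, p i ↔ q i := by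
  refine Quotient.eq.trans ?_
  change symmDiff {i | p i} {i | q i} ∈ 𝓘 ↔ {i | p i ↔ q i}ᶜ ∈ 𝓘
  have : symmDiff {i | p i} {i | q i} = {i | p i ↔ q i}ᶜ := by
    ext i
    simp only [Set.mem_symmDiff, Set.mem_ofPred_eq, Set.mem_compl_iff]
    tauto
  rw [this]

theorem mul_mainClass (a b : ι → Equiv.Perm (Fin 3)) :
    (symThreeReducedPower 𝓘).mul (mainClass 𝓘 a) (mainClass 𝓘 b) =
      mainClass 𝓘 (fun i => a i * b i) := rfl

theorem supp₂_mainClass (a : ι → Equiv.Perm (Fin 3)) :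
    (symThreeReducedPower 𝓘).supp₂ (mainClass 𝓘 a) = algClass 𝓘 (fun i => a i ^ 2 = 1) := rfl

theorem supp₃_mainClass (a : ι → Equiv.Perm (Fin 3)) :
    (symThreeReducedPower 𝓘).supp₃ (mainClass 𝓘 a) = algClass 𝓘 (fun i => a i ^ 3 = 1) := rfl

theorem disj_algClass_iff {p q : ι → Prop} :
    (symThreeReducedPower 𝓘).Disj (algClass 𝓘 p) (algClass 𝓘 q) ↔
      ∀ᶠ i in dualFilter 𝓘, p i → ¬q i := by
  refine ⟨fun h => ?_, fun h r hp hq s => ?_⟩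
  -- Disjointness is tested on the meet of the two classes, compared with the bottom class.
  · have := h (algClass 𝓘 fun i => p i ∧ q i) (algClass_le_iff.2 (.of_forall fun i hi => hi.1))
      (algClass_le_iff.2 (.of_forall fun i hi => hi.2)) (algClass 𝓘 fun _ => False)
    filter_upwards [algClass_le_iff.1 this] with i hi hp hq using hi ⟨hp, hq⟩
  · obtain ⟨r, rfl⟩ := algClass_surjective 𝓘 r
    obtain ⟨s, rfl⟩ := algClass_surjective 𝓘 s
    refine algClass_le_iff.2 ?_
    filter_upwards [h, algClass_le_iff.1 hp, algClass_le_iff.1 hq] with i h₁ h₂ h₃ h₄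
    exact absurd (h₃ h₄) (h₁ (h₂ h₄))

theorem forall_le_algClass_iff {p : ι → Prop} :
    (∀ s, (symThreeReducedPower 𝓘).le s (algClass 𝓘 p)) ↔ ∀ᶠ i in dualFilter 𝓘, p i := by
  refine ⟨fun h => ?_, fun h s => ?_⟩
  · filter_upwards [algClass_le_iff.1 (h (algClass 𝓘 fun _ => True))] with i hi using hi trivial
  · obtain ⟨s, rfl⟩ := algClass_surjective 𝓘 s
    refine algClass_le_iff.2 ?_
    filter_upwards [h] with i hi _ using hi

/-- The pieces of a finite partition cover, so an element is determined once each piece is known to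
lie below it or to be disjoint from it. This lets joins be expressed by the order alone. -/
theorem isJoin_algClass_iff {κ : Type w} [Finite κ] (f : ι → κ) (T : κ → Prop)
    (q : (symThreeReducedPower 𝓘).P) :
    (symThreeReducedPower 𝓘).IsJoin (fun c => algClass 𝓘 fun i => f i = c) T q ↔
      q = algClass 𝓘 fun i => T (f i) := by
  obtain ⟨q, rfl⟩ := algClass_surjective 𝓘 q
  rw [algClass_eq_iff]
  constructor
  · intro h
    have h' : ∀ c, ∀ᶠ i in dualFilter 𝓘, f i = c → (q i ↔ T c) := fun c => by
      by_cases hc : T c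
      · filter_upwards [algClass_le_iff.1 ((h c).1 hc)] with i hi e
        exact iff_of_true (hi e) hc
      · filter_upwards [disj_algClass_iff.1 ((h c).2 hc)] with i hi e
        exact iff_of_false (hi e) hc
    filter_upwards [eventually_all.2 h'] with i hi using hi _ rfl
  · refine fun h c => ⟨fun hc => algClass_le_iff.2 ?_, fun hc => disj_algClass_iff.2 ?_⟩
    · filter_upwards [h] with i hi e
      exact hi.2 (e ▸ hc)
    · filter_upwards [h] with i hi e hq
      exact hc (e ▸ hi.1 hq)

/-- The partitions of unity of `𝒫(ι) / 𝓘` come from partitions of `ι`. -/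
theorem isPartition_iff {κ : Type w} [Finite κ] [Nonempty κ]
    (Z : κ → (symThreeReducedPower 𝓘).P) :
    (symThreeReducedPower 𝓘).IsPartition Z ↔
      ∃ f : ι → κ, Z = fun c => algClass 𝓘 fun i => f i = c := by
  constructor
  · rintro ⟨hd, hc⟩
    choose z hz using fun c => algClass_surjective 𝓘 (Z c)
    obtain rfl : (fun c => algClass 𝓘 (z c)) = Z := funext hz
    have hd' : ∀ᶠ i in dualFilter 𝓘, ∀ c d, c ≠ d → z c i → ¬z d i :=
      eventually_all.2 fun c => eventually_all.2 fun d => by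
        by_cases h : c = d
        · simp [h]
        · filter_upwards [disj_algClass_iff.1 (hd c d h)] with i hi _ using hi
    have hc' : ∀ᶠ i in dualFilter 𝓘, ∃ c, z c i :=
      forall_le_algClass_iff.1 (hc (algClass 𝓘 fun i => ∃ c, z c i) fun c =>
        algClass_le_iff.2 (.of_forall fun i hi => ⟨c, hi⟩))
    -- As the index set is finite, almost every coordinate lies in exactly one representative; on
    -- the negligible rest the chosen index is arbitrary.
    refine ⟨fun i => Classical.epsilon fun c => z c i, funext fun c => algClass_eq_iff.2 ?_⟩
    filter_upwards [hd', hc'] with i h₁ h₂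
    have h₃ := Classical.epsilon_spec h₂
    refine ⟨fun h => ?_, fun h => h ▸ h₃⟩
    by_contra h'
    exact h₁ _ _ h' h₃ h
  · rintro ⟨f, rfl⟩
    refine ⟨fun c d h => disj_algClass_iff.2 (.of_forall fun i hc hd => h (hc.symm.trans hd)),
      fun p hp s => ?_⟩
    obtain ⟨p, rfl⟩ := algClass_surjective 𝓘 p
    revert s
    rw [forall_le_algClass_iff]
    filter_upwards [eventually_all.2 fun c => algClass_le_iff.1 (hp c)] with i hi using hi _ rfl

end DualFilter

/-! ### Interpretation of the second sort in the group -/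

section Interpretation

variable {ι : Type u} {𝓘 : Order.Ideal (Set ι)}

-- The hypotheses put `d` and `e` in 𝔄₃, with `e` trivial if `d` is. If `e = 1` there is nothing to
-- prove; otherwise `d` and `e` are both 3-cycles, with the same centralizer 𝔄₃.
set_option synthInstance.maxSize 1000 in
set_option maxRecDepth 10000 in
theorem perm_commute_of_commute : ∀ d e : Equiv.Perm (Fin 3), d ^ 3 = 1 → e ^ 3 = 1 →
    (d ^ 2 = 1 → e ^ 2 = 1) → ∀ h, h * d = d * h → h * e = e * h := by
  decide

theorem perm_forall_cube : ∀ d : Equiv.Perm (Fin 3), d * d * d = 1 ↔ d ^ 3 = 1 := by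
  decide

/-- `d ^ 3 = e`, in the language of multiplication only. -/
def IsCubeTrivial (S : StarStructure.{u, v}) (d : S.G) : Prop :=
  ∀ h, S.mul (S.mul (S.mul d d) d) h = h

theorem isCubeTrivial_mainClass {d : ι → Equiv.Perm (Fin 3)} :
    IsCubeTrivial (symThreeReducedPower 𝓘) (mainClass 𝓘 d) ↔
      ∀ᶠ i in dualFilter 𝓘, d i ^ 3 = 1 := by
  constructor
  · intro h
    have := h (mainClass 𝓘 fun _ => 1)
    simp only [mul_mainClass, mainClass_eq_iff] at this
    filter_upwards [this] with i hi
    rw [mul_one] at hi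
    exact (perm_forall_cube _).1 hi
  · intro h g
    obtain ⟨g, rfl⟩ := mainClass_surjective 𝓘 g
    simp only [mul_mainClass, mainClass_eq_iff]
    filter_upwards [h] with i hi
    rw [(perm_forall_cube _).2 hi, one_mul]

/-- The centralizer of `d` is contained in that of `e`. -/
def CentralizerLE (S : StarStructure.{u, v}) (d e : S.G) : Prop :=
  ∀ h, S.mul h d = S.mul d h → S.mul h e = S.mul e h

theorem perm_swap_commute : ∀ e : Equiv.Perm (Fin 3), e ^ 3 = 1 →
    Equiv.swap 0 1 * e = e * Equiv.swap 0 1 → e ^ 2 = 1 := by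
  decide

theorem perm_eq_one : ∀ e : Equiv.Perm (Fin 3), e ^ 3 = 1 → e ^ 2 = 1 → e = 1 := by
  decide

theorem centralizerLE_iff {d e : (symThreeReducedPower 𝓘).G}
    (hd : IsCubeTrivial (symThreeReducedPower 𝓘) d)
    (he : IsCubeTrivial (symThreeReducedPower 𝓘) e) :
    CentralizerLE (symThreeReducedPower 𝓘) d e ↔
      (symThreeReducedPower 𝓘).le ((symThreeReducedPower 𝓘).supp₂ d)
        ((symThreeReducedPower 𝓘).supp₂ e) := by
  classical
  obtain ⟨d, rfl⟩ := mainClass_surjective 𝓘 d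
  obtain ⟨e, rfl⟩ := mainClass_surjective 𝓘 e
  rw [isCubeTrivial_mainClass] at hd he
  rw [supp₂_mainClass, supp₂_mainClass, algClass_le_iff]
  constructor
  · intro h
    -- A transposition exactly where `d` is trivial: it commutes with `d`, and commuting with `e`
    -- forces `e` to be trivial there too.
    have := h (mainClass 𝓘 fun i => if d i ^ 2 = 1 then Equiv.swap 0 1 else 1)
    simp only [mul_mainClass, mainClass_eq_iff] at this
    have h' : ∀ᶠ i in dualFilter 𝓘, (if d i ^ 2 = 1 then Equiv.swap 0 1 else 1) * d i =
        d i * (if d i ^ 2 = 1 then Equiv.swap 0 1 else 1) := by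
      filter_upwards [hd] with i hi
      split_ifs with h₂
      · simp [perm_eq_one _ hi h₂]
      · simp
    filter_upwards [this h', he] with i h₁ h₂ h₃
    rw [if_pos h₃] at h₁
    exact perm_swap_commute _ h₂ h₁
  · intro h g hg
    obtain ⟨g, rfl⟩ := mainClass_surjective 𝓘 g
    simp only [mul_mainClass, mainClass_eq_iff] at hg ⊢
    filter_upwards [h, hd, he, hg] with i h₁ h₂ h₃ h₄
    exact perm_commute_of_commute _ _ h₂ h₃ h₁ _ h₄

-- A square is trivial on involutions and is again a 3-cycle on 3-cycles.
set_option maxRecDepth 10000 in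
theorem perm_cube_sq : ∀ d : Equiv.Perm (Fin 3),
    (d * d) ^ 3 = 1 ∧ ((d * d) ^ 2 = 1 ↔ d ^ 2 = 1) := by
  decide

theorem isCubeTrivial_mul_self (g : (symThreeReducedPower 𝓘).G) :
    IsCubeTrivial (symThreeReducedPower 𝓘) ((symThreeReducedPower 𝓘).mul g g) := by
  obtain ⟨g, rfl⟩ := mainClass_surjective 𝓘 g
  rw [mul_mainClass, isCubeTrivial_mainClass]
  exact .of_forall fun i => (perm_cube_sq _).1

theorem supp₂_mul_self (g : (symThreeReducedPower 𝓘).G) :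
    (symThreeReducedPower 𝓘).supp₂ ((symThreeReducedPower 𝓘).mul g g) =
      (symThreeReducedPower 𝓘).supp₂ g := by
  obtain ⟨g, rfl⟩ := mainClass_surjective 𝓘 g
  rw [mul_mainClass, supp₂_mainClass, supp₂_mainClass, algClass_eq_iff]
  exact .of_forall fun i => (perm_cube_sq _).2

theorem perm_finRotate : (finRotate 3) ^ 3 = 1 ∧ ¬(finRotate 3) ^ 2 = 1 := by
  decide

theorem exists_isCubeTrivial_supp₂ (p : (symThreeReducedPower 𝓘).P) :
    ∃ d, IsCubeTrivial (symThreeReducedPower 𝓘) d ∧ (symThreeReducedPower 𝓘).supp₂ d = p := by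
  classical
  obtain ⟨p, rfl⟩ := algClass_surjective 𝓘 p
  refine ⟨mainClass 𝓘 fun i => if p i then 1 else finRotate 3, ?_, ?_⟩
  · refine isCubeTrivial_mainClass.2 (.of_forall fun i => ?_)
    split_ifs
    exacts [one_pow _, perm_finRotate.1]
  · refine algClass_eq_iff.2 (.of_forall fun i => ?_)
    dsimp only
    split_ifs with h
    · simp [h]
    · exact iff_of_false perm_finRotate.2 h

theorem le_antisymm_iff_eq {p q : (symThreeReducedPower 𝓘).P} :
    ((symThreeReducedPower 𝓘).le p q ∧ (symThreeReducedPower 𝓘).le q p) ↔ p = q := by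
  obtain ⟨p, rfl⟩ := algClass_surjective 𝓘 p
  obtain ⟨q, rfl⟩ := algClass_surjective 𝓘 q
  rw [algClass_le_iff, algClass_le_iff, algClass_eq_iff, ← eventually_and]
  simp only [iff_def]

/-- The second support of `d` is the third support of `g`: the element `d` is inverted by `g`,
and has the largest possible set of nontrivial coordinates among such elements of order
dividing `3`. -/
def IsMaxInverted (S : StarStructure.{u, v}) (g d : S.G) : Prop :=
  S.mul (S.mul d g) d = g ∧
    ∀ z, IsCubeTrivial S z → S.mul (S.mul z g) z = g → CentralizerLE S d z

-- If `g` is a transposition it inverts `d`, so `d * g * d = g` always holds. If `g` lies in 𝔄₃ it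
-- commutes with `d`, and the equation says `d ^ 2 = 1`.
set_option maxRecDepth 10000 in
theorem perm_inverted_iff : ∀ d g : Equiv.Perm (Fin 3), d ^ 3 = 1 →
    (d * g * d = g ↔ (g ^ 3 = 1 → d ^ 2 = 1)) := by
  decide

theorem isMaxInverted_iff {g d : (symThreeReducedPower 𝓘).G}
    (hd : IsCubeTrivial (symThreeReducedPower 𝓘) d) :
    IsMaxInverted (symThreeReducedPower 𝓘) g d ↔
      (symThreeReducedPower 𝓘).supp₃ g = (symThreeReducedPower 𝓘).supp₂ d := by
  have key : ∀ z, IsCubeTrivial (symThreeReducedPower 𝓘) z →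
      ((symThreeReducedPower 𝓘).mul ((symThreeReducedPower 𝓘).mul z g) z = g ↔
        (symThreeReducedPower 𝓘).le ((symThreeReducedPower 𝓘).supp₃ g)
          ((symThreeReducedPower 𝓘).supp₂ z)) := by
    intro z hz
    obtain ⟨z, rfl⟩ := mainClass_surjective 𝓘 z
    obtain ⟨g, rfl⟩ := mainClass_surjective 𝓘 g
    rw [isCubeTrivial_mainClass] at hz
    rw [mul_mainClass, mul_mainClass, mainClass_eq_iff, supp₃_mainClass, supp₂_mainClass,
      algClass_le_iff]
    refine eventually_congr ?_
    filter_upwards [hz] with i hi using perm_inverted_iff _ _ hi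
  have refl : ∀ p, (symThreeReducedPower 𝓘).le p p := fun p => (le_antisymm_iff_eq.2 rfl).1
  rw [← le_antisymm_iff_eq, IsMaxInverted, key d hd]
  refine and_congr_right fun _ => ⟨fun h => ?_, fun h z hz hzg => ?_⟩
  -- Maximality is applied to the optimal competitor, whose second support is exactly `supp₃ g`.
  · obtain ⟨z, hz, hzg⟩ := exists_isCubeTrivial_supp₂ ((symThreeReducedPower 𝓘).supp₃ g)
    rw [← hzg]
    refine (centralizerLE_iff hd hz).1 (h z hz ((key z hz).2 ?_))
    rw [hzg]
    exact refl _
  · rw [centralizerLE_iff hd hz]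
    rw [key z hz] at hzg
    obtain ⟨d, rfl⟩ := mainClass_surjective 𝓘 d
    obtain ⟨z, rfl⟩ := mainClass_surjective 𝓘 z
    obtain ⟨g, rfl⟩ := mainClass_surjective 𝓘 g
    rw [supp₂_mainClass, supp₃_mainClass, algClass_le_iff] at *
    rw [supp₂_mainClass, algClass_le_iff]
    filter_upwards [h, hzg] with i h₁ h₂ h₃ using h₂ (h₁ h₃)


/-! ### Definability of these conditions in the language of multiplication -/

theorem IsTermFun.comp {L : FirstOrder.Language.{0, 0}} {M : Type v} [L.Structure M]
    {α β : Type*} {f : (α → M) → M} (hf : IsTermFun L f) (e : α → β) :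
    IsTermFun L (fun v : β → M => f (v ∘ e)) := by
  obtain ⟨t, ht⟩ := hf
  exact ⟨t.relabel e, fun v => by rw [FirstOrder.Language.Term.realize_relabel, ht]⟩

namespace FODefinable

variable {S : StarStructure.{u, v}} {α : Type*}

theorem isCubeTrivial {f : (α → S.G) → S.G} (hf : IsTermFun mulLanguage f) :
    FODefinable mulLanguage (fun v : α → S.G => IsCubeTrivial S (f v)) :=
  have hf' := hf.comp (Sum.inl (β := Unit))
  forall_elem (eq (((hf'.mul hf').mul hf').mul (.var (Sum.inr ()))) (.var (Sum.inr ())))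

theorem centralizerLE {f g : (α → S.G) → S.G} (hf : IsTermFun mulLanguage f)
    (hg : IsTermFun mulLanguage g) :
    FODefinable mulLanguage (fun v : α → S.G => CentralizerLE S (f v) (g v)) :=
  have hf' := hf.comp (Sum.inl (β := Unit))
  have hg' := hg.comp (Sum.inl (β := Unit))
  have hz := IsTermFun.var (L := mulLanguage) (M := S.G) (Sum.inr () : α ⊕ Unit)
  forall_elem ((eq (hz.mul hf') (hf'.mul hz)).imp (eq (hz.mul hg') (hg'.mul hz)))

theorem isMaxInverted {f g : (α → S.G) → S.G} (hf : IsTermFun mulLanguage f)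
    (hg : IsTermFun mulLanguage g) :
    FODefinable mulLanguage (fun v : α → S.G => IsMaxInverted S (f v) (g v)) :=
  have hf' := hf.comp (Sum.inl (β := Unit))
  have hg' := hg.comp (Sum.inl (β := Unit))
  have hz := IsTermFun.var (L := mulLanguage) (M := S.G) (Sum.inr () : α ⊕ Unit)
  (eq ((hg.mul hf).mul hg) hf).and
    (forall_elem ((isCubeTrivial hz).imp ((eq ((hz.mul hf').mul hz) hf').imp
      (centralizerLE hg' hz))))

end FODefinable

theorem isInterpretableExpansion_symThreeReducedPower {ι : Type u} (𝓘 : Order.Ideal (Set ι)) :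
    (symThreeReducedPower 𝓘).IsInterpretableExpansion := by
  refine ⟨1, {w | IsCubeTrivial _ (w 0)}, fun d => (symThreeReducedPower 𝓘).supp₂ (d.1 0),
    fun p => ?_, (FODefinable.isCubeTrivial (.var 0)).definable, ?_, ?_, ?_, ?_⟩
  · obtain ⟨d, hd, hp⟩ := exists_isCubeTrivial_supp₂ p
    exact ⟨⟨fun _ => d, hd⟩, hp⟩
  · refine FODefinable.definable (FODefinable.congr
      ((FODefinable.isCubeTrivial (.var (Sum.inl 0))).and
      ((FODefinable.isCubeTrivial (.var (Sum.inr 0))).and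
      ((FODefinable.centralizerLE (.var (Sum.inl 0)) (.var (Sum.inr 0))).and
      (FODefinable.centralizerLE (.var (Sum.inr 0)) (.var (Sum.inl 0)))))) fun w => ?_)
    constructor
    · rintro ⟨h, h', h₁, h₂⟩
      exact ⟨h, h', le_antisymm_iff_eq.1 ⟨(centralizerLE_iff h h').1 h₁,
        (centralizerLE_iff h' h).1 h₂⟩⟩
    · rintro ⟨h, h', e⟩
      obtain ⟨h₁, h₂⟩ := le_antisymm_iff_eq.2 e
      exact ⟨h, h', (centralizerLE_iff h h').2 h₁, (centralizerLE_iff h' h).2 h₂⟩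
  · refine FODefinable.definable (FODefinable.congr
      ((FODefinable.isCubeTrivial (.var (Sum.inl 0))).and
      ((FODefinable.isCubeTrivial (.var (Sum.inr 0))).and
      (FODefinable.centralizerLE (.var (Sum.inl 0)) (.var (Sum.inr 0))))) fun w => ?_)
    constructor
    · rintro ⟨h, h', h₁⟩
      exact ⟨h, h', (centralizerLE_iff h h').1 h₁⟩
    · rintro ⟨h, h', h₁⟩
      exact ⟨h, h', (centralizerLE_iff h h').2 h₁⟩
  · have hg := IsTermFun.var (L := mulLanguage) (M := (symThreeReducedPower 𝓘).G)
      (Sum.inl () : Unit ⊕ Fin 1)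
    refine FODefinable.definable (FODefinable.congr
      ((FODefinable.isCubeTrivial (.var (Sum.inr 0))).and
      ((FODefinable.centralizerLE (hg.mul hg) (.var (Sum.inr 0))).and
      (FODefinable.centralizerLE (.var (Sum.inr 0)) (hg.mul hg)))) fun w => ?_)
    have h' := isCubeTrivial_mul_self (w (Sum.inl ()))
    constructor
    · rintro ⟨h, h₁, h₂⟩
      refine ⟨h, (supp₂_mul_self _).symm.trans ?_⟩
      exact le_antisymm_iff_eq.1 ⟨(centralizerLE_iff h' h).1 h₁, (centralizerLE_iff h h').1 h₂⟩
    · rintro ⟨h, e⟩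
      obtain ⟨h₁, h₂⟩ := le_antisymm_iff_eq.2 ((supp₂_mul_self _).trans e)
      exact ⟨h, (centralizerLE_iff h' h).2 h₁, (centralizerLE_iff h h').2 h₂⟩
  · refine FODefinable.definable (FODefinable.congr
      ((FODefinable.isCubeTrivial (.var (Sum.inr 0))).and
      (FODefinable.isMaxInverted (.var (Sum.inl ())) (.var (Sum.inr 0)))) fun w => ?_)
    constructor
    · rintro ⟨h, h₁⟩
      exact ⟨h, (isMaxInverted_iff h).1 h₁⟩
    · rintro ⟨h, h₁⟩
      exact ⟨h, (isMaxInverted_iff h).2 h₁⟩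

/-! ### Types of tuples in the symmetric group -/

section TupleTypes

/-- The value of a term of the main sort in a type with multiplication. -/
def MainTerm.value {M : Type w} [Mul M] {m : ℕ} (x : Fin m → M) : MainTerm m → M
  | .var i => x i
  | .mul s t => s.value x * t.value x

theorem MainTerm.value_conj {M : Type w} [Group M] {m : ℕ} (g : M) (x : Fin m → M)
    (t : MainTerm m) : t.value (fun k => g * x k * g⁻¹) = g * t.value x * g⁻¹ := by
  induction t with
  | var i => rfl
  | mul s t hs ht => simp only [value, hs, ht]; group

/-- Simultaneous conjugacy of tuples of permutations. -/
def conjSetoid (m : ℕ) : Setoid (Fin m → Equiv.Perm (Fin 3)) where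
  r c d := ∃ g, d = fun k => g * c k * g⁻¹
  iseqv :=
    { refl := fun c => ⟨1, by simp⟩
      symm := fun {c d} h => by
        obtain ⟨g, rfl⟩ := h
        exact ⟨g⁻¹, by ext1 k; group⟩
      trans := fun {c d e} h₁ h₂ => by
        obtain ⟨g, rfl⟩ := h₁
        obtain ⟨h, rfl⟩ := h₂
        exact ⟨h * g, by ext1 k; group⟩ }

/-- The types over the empty set of `m`-tuples of elements of `𝔖₃`. -/
abbrev TupleType (m : ℕ) : Type := Quotient (conjSetoid m)

/-- The type of a tuple. -/
def tupleType {m : ℕ} (c : Fin m → Equiv.Perm (Fin 3)) : TupleType m :=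
  Quotient.mk (conjSetoid m) c

theorem tupleType_eq_iff {m : ℕ} {c d : Fin m → Equiv.Perm (Fin 3)} :
    tupleType c = tupleType d ↔ ∃ g, d = fun k => g * c k * g⁻¹ :=
  Quotient.eq

instance (m : ℕ) : Finite (TupleType m) := Quotient.finite _

instance (m : ℕ) : Nonempty (TupleType m) := ⟨tupleType 1⟩

/-- The restriction of a type to the first variables. -/
def TupleType.init {m : ℕ} : TupleType (m + 1) → TupleType m :=
  Quotient.map (sa := conjSetoid (m + 1)) (sb := conjSetoid m) Fin.init (by
    rintro c _ ⟨g, rfl⟩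
    exact ⟨g, rfl⟩)

theorem TupleType.init_tupleType {m : ℕ} (c : Fin (m + 1) → Equiv.Perm (Fin 3)) :
    (tupleType c).init = tupleType (Fin.init c) := rfl

/-- Homogeneity: the conjugation carrying the first `m` entries of a realization of `p` to `c` also
carries its last entry to the required `g`. -/
theorem exists_tupleType_snoc {m : ℕ} {c : Fin m → Equiv.Perm (Fin 3)} {p : TupleType (m + 1)}
    (h : p.init = tupleType c) :
    ∃ g : Equiv.Perm (Fin 3),
      tupleType (Fin.snoc (α := fun _ => Equiv.Perm (Fin 3)) c g) = p := by
  obtain ⟨d, rfl⟩ : ∃ d, tupleType d = p := Quotient.mk_surjective p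
  rw [TupleType.init_tupleType, tupleType_eq_iff] at h
  obtain ⟨g, rfl⟩ := h
  refine ⟨g * d (Fin.last m) * g⁻¹, (tupleType_eq_iff.2 ⟨g, ?_⟩).symm⟩
  ext1 k
  refine Fin.lastCases ?_ (fun k => ?_) k
  · simp
  · simp [Fin.init]

/-- A property of tuples invariant under conjugation, as a property of types. -/
theorem exists_tupleType_pred {m : ℕ} (Q : (Fin m → Equiv.Perm (Fin 3)) → Prop)
    (hQ : ∀ g c, Q c → Q (fun k => g * c k * g⁻¹)) :
    ∃ T : TupleType m → Prop, ∀ c, T (tupleType c) ↔ Q c := by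
  refine ⟨fun p => ∃ d, tupleType d = p ∧ Q d, fun c => ⟨?_, fun h => ⟨c, rfl, h⟩⟩⟩
  rintro ⟨d, e, h⟩
  obtain ⟨g, rfl⟩ := tupleType_eq_iff.1 e
  exact hQ g d h

theorem exists_tupleType_pow {m : ℕ} (t : MainTerm m) (n : ℕ) :
    ∃ T : TupleType m → Prop, ∀ c, T (tupleType c) ↔ t.value c ^ n = 1 :=
  exists_tupleType_pred _ fun g c h => by
    rw [MainTerm.value_conj, conj_pow, h, mul_one, mul_inv_cancel]

/-! ### Words and conjugacy in 𝔖₃ -/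

/-- A noncommuting pair generates 𝔖₃ and contains a transposition, so the identity is among the two
squares. -/
theorem perm_eq_word_of_not_commute : ∀ a b : Equiv.Perm (Fin 3), a * b ≠ b * a → ∀ x,
    x = a ∨ x = b ∨ x = a * a ∨ x = b * b ∨ x = a * b ∨ x = b * a ∨ x = a * b * a := by
  decide

/-- The centralizer of a nontrivial element of 𝔖₃ is the cyclic group it generates. -/
theorem perm_eq_pow_of_commute : ∀ a : Equiv.Perm (Fin 3), a ≠ 1 → ∀ x, x * a = a * x →
    x = a ∨ x = a * a ∨ x = a * a * a := by
  decide

-- Noncommuting elements are nontrivial, so `a ^ 2 = 1` tells transpositions from 3-cycles; 𝔖₃ acts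
-- simply transitively on the noncommuting pairs of given orders.
set_option synthInstance.maxSize 1000 in
set_option maxRecDepth 100000 in
theorem perm_exists_conj_pair : ∀ a b : Equiv.Perm (Fin 3), a * b ≠ b * a →
    ∀ a', (a ^ 2 = 1 ↔ a' ^ 2 = 1) → ∀ b', (b ^ 2 = 1 ↔ b' ^ 2 = 1) → a' * b' ≠ b' * a' →
    ∃ g, a' = g * a * g⁻¹ ∧ b' = g * b * g⁻¹ := by
  decide

set_option maxRecDepth 10000 in
theorem perm_exists_conj : ∀ a a' : Equiv.Perm (Fin 3), (a ^ 2 = 1 ↔ a' ^ 2 = 1) →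
    (a ^ 3 = 1 ↔ a' ^ 3 = 1) → ∃ g, a' = g * a * g⁻¹ := by
  decide

-- The exponent of 𝔖₃ is 6, so `b ^ 5` stands in for the inverse, which terms lack.
set_option maxRecDepth 10000 in
theorem perm_mul_pow_five_eq_one_iff : ∀ a b : Equiv.Perm (Fin 3),
    a * (b * (b * (b * (b * b)))) = 1 ↔ a = b := by
  decide

theorem perm_eq_one_iff (a : Equiv.Perm (Fin 3)) : a = 1 ↔ a ^ 2 = 1 ∧ a ^ 3 = 1 := by
  refine ⟨fun h => by simp [h], fun h => ?_⟩
  have := h.2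
  rwa [pow_succ, h.1, one_mul] at this

/-- The type of a tuple is determined by the words whose value has order dividing `2`, and by
those whose value has order dividing `3`. -/
theorem tupleType_eq_of_value_pow {m : ℕ} {c d : Fin m → Equiv.Perm (Fin 3)}
    (h₂ : ∀ t : MainTerm m, t.value c ^ 2 = 1 ↔ t.value d ^ 2 = 1)
    (h₃ : ∀ t : MainTerm m, t.value c ^ 3 = 1 ↔ t.value d ^ 3 = 1) :
    tupleType c = tupleType d := by
  have h₁ : ∀ t : MainTerm m, t.value c = 1 ↔ t.value d = 1 := fun t => by
    rw [perm_eq_one_iff, perm_eq_one_iff (t.value d), h₂, h₃]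
  have hw : ∀ s t : MainTerm m, s.value c = t.value c ↔ s.value d = t.value d := by
    intro s t
    have := h₁ (.mul s (.mul t (.mul t (.mul t (.mul t t)))))
    simpa only [MainTerm.value, perm_mul_pow_five_eq_one_iff] using this
  refine tupleType_eq_iff.2 ?_
  -- The entries generate 𝔖₃, a nontrivial cyclic group, or the trivial group. In each case one
  -- conjugator fits the generators, and every other entry follows as a word in them, since `hw`
  -- transfers equations between words.
  by_cases hc : ∃ i j, c i * c j ≠ c j * c i
  · obtain ⟨i, j, hij⟩ := hc
    have hij' : d i * d j ≠ d j * d i := fun e => hij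
      ((hw (.mul (.var i) (.var j)) (.mul (.var j) (.var i))).2 e)
    obtain ⟨g, hi, hj⟩ := perm_exists_conj_pair _ _ hij _ (h₂ (.var i)) _ (h₂ (.var j)) hij'
    replace hi : d i = g * c i * g⁻¹ := hi
    replace hj : d j = g * c j * g⁻¹ := hj
    have : ∀ t : MainTerm m, t.value d = g * t.value c * g⁻¹ → ∀ k, c k = t.value c →
        d k = g * c k * g⁻¹ := fun t ht k hk => by
      rw [hk, ← ht]
      exact (hw (.var k) t).1 hk
    refine ⟨g, funext fun k => ?_⟩
    rcases perm_eq_word_of_not_commute _ _ hij (c k) with h | h | h | h | h | h | h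
    · exact this (.var i) hi k h
    · exact this (.var j) hj k h
    · exact this (.mul (.var i) (.var i)) (by simp [MainTerm.value, hi]) k h
    · exact this (.mul (.var j) (.var j)) (by simp [MainTerm.value, hj]) k h
    · exact this (.mul (.var i) (.var j)) (by simp [MainTerm.value, hi, hj]) k h
    · exact this (.mul (.var j) (.var i)) (by simp [MainTerm.value, hi, hj]) k h
    · exact this (.mul (.mul (.var i) (.var j)) (.var i))
        (by simp [MainTerm.value, hi, hj, mul_assoc]) k h
  · push Not at hc
    by_cases h : ∃ i, c i ≠ 1
    · obtain ⟨i, hi⟩ := h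
      obtain ⟨g, hg⟩ := perm_exists_conj _ _ (h₂ (.var i)) (h₃ (.var i))
      replace hg : d i = g * c i * g⁻¹ := hg
      have : ∀ t : MainTerm m, t.value d = g * t.value c * g⁻¹ → ∀ k, c k = t.value c →
          d k = g * c k * g⁻¹ := fun t ht k hk => by
        rw [hk, ← ht]
        exact (hw (.var k) t).1 hk
      refine ⟨g, funext fun k => ?_⟩
      rcases perm_eq_pow_of_commute _ hi (c k) (hc k i) with h | h | h
      · exact this (.var i) hg k h
      · exact this (.mul (.var i) (.var i)) (by simp [MainTerm.value, hg]) k h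
      · exact this (.mul (.mul (.var i) (.var i)) (.var i)) (by simp [MainTerm.value, hg]) k h
    · push Not at h
      refine ⟨1, funext fun k => ?_⟩
      have : d k = 1 := (h₁ (.var k)).1 (h k)
      simp [this, h k]

end TupleTypes

/-! ### Relative quantifier elimination -/

section QuantifierElimination

variable {ι : Type u} {𝓘 : Order.Ideal (Set ι)}

/-- The Boolean value of each type at a tuple of families. -/
def typeValue (𝓘 : Order.Ideal (Set ι)) {m : ℕ} (a : Fin m → ι → Equiv.Perm (Fin 3)) :
    TupleType m → (symThreeReducedPower 𝓘).P :=
  fun c => algClass 𝓘 fun i => tupleType (fun k => a k i) = c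

theorem isJoin_typeValue {m : ℕ} (a : Fin m → ι → Equiv.Perm (Fin 3)) (T : TupleType m → Prop)
    (q : (symThreeReducedPower 𝓘).P) :
    (symThreeReducedPower 𝓘).IsJoin (typeValue 𝓘 a) T q ↔
      q = algClass 𝓘 fun i => T (tupleType fun k => a k i) :=
  isJoin_algClass_iff _ T q

theorem MainTerm.eval_mainClass {m : ℕ} (a : Fin m → ι → Equiv.Perm (Fin 3)) (t : MainTerm m) :
    t.eval (symThreeReducedPower 𝓘) (fun k => mainClass 𝓘 (a k)) =
      mainClass 𝓘 (fun i => t.value fun k => a k i) := by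
  induction t with
  | var k => rfl
  | mul s t hs ht => rw [eval, hs, ht, mul_mainClass]; rfl

theorem snoc_mainClass {m : ℕ} (a : Fin m → ι → Equiv.Perm (Fin 3))
    (b : ι → Equiv.Perm (Fin 3)) :
    (Fin.snoc (fun k => mainClass 𝓘 (a k)) (mainClass 𝓘 b) :
        Fin (m + 1) → (symThreeReducedPower 𝓘).G) =
      fun k => mainClass 𝓘 ((Fin.snoc a b : Fin (m + 1) → ι → Equiv.Perm (Fin 3)) k) := by
  ext1 k
  refine Fin.lastCases ?_ (fun k => ?_) k <;> simp

theorem snoc_apply {m : ℕ} (a : Fin m → ι → Equiv.Perm (Fin 3)) (b : ι → Equiv.Perm (Fin 3))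
    (i : ι) :
    (fun k => (Fin.snoc a b : Fin (m + 1) → ι → Equiv.Perm (Fin 3)) k i) =
      (Fin.snoc (fun k => a k i) (b i) : Fin (m + 1) → Equiv.Perm (Fin 3)) := by
  ext1 k
  refine Fin.lastCases ?_ (fun k => ?_) k <;> simp

/-- The value of a term of the second sort is definable from the values of the types. -/
theorem exists_definable_algTerm {m n : ℕ} (τ : AlgTerm m n) :
    ∃ E : ((TupleType m ⊕ Fin n) → (symThreeReducedPower 𝓘).P) →
        (symThreeReducedPower 𝓘).P → Prop,
      FODefinable FirstOrder.Language.order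
        (fun w : (TupleType m ⊕ Fin n) ⊕ Unit → (symThreeReducedPower 𝓘).P =>
          E (w ∘ Sum.inl) (w (Sum.inr ()))) ∧
      ∀ (a : Fin m → ι → Equiv.Perm (Fin 3)) (y : Fin n → (symThreeReducedPower 𝓘).P) (q),
        E (Sum.elim (typeValue 𝓘 a) y) q ↔
          q = τ.eval (symThreeReducedPower 𝓘) (fun k => mainClass 𝓘 (a k)) y := by
  cases τ with
  | var j =>
    exact ⟨fun v q => q = v (Sum.inr j), .eq (.var (Sum.inr ())) (.var (Sum.inl (Sum.inr j))),
      fun a y q => Iff.rfl⟩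
  | supp₂ t =>
    obtain ⟨T, hT⟩ := exists_tupleType_pow t 2
    refine ⟨fun v q => StarStructure.IsJoin _ (fun c => v (Sum.inl c)) T q,
      .isJoin (fun c => Sum.inl (Sum.inl c)) T (Sum.inr ()), fun a y q => ?_⟩
    rw [AlgTerm.eval, MainTerm.eval_mainClass, supp₂_mainClass]
    refine (isJoin_typeValue a T q).trans ?_
    simp only [hT]
  | supp₃ t =>
    obtain ⟨T, hT⟩ := exists_tupleType_pow t 3
    refine ⟨fun v q => StarStructure.IsJoin _ (fun c => v (Sum.inl c)) T q,
      .isJoin (fun c => Sum.inl (Sum.inl c)) T (Sum.inr ()), fun a y q => ?_⟩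
    rw [AlgTerm.eval, MainTerm.eval_mainClass, supp₃_mainClass]
    refine (isJoin_typeValue a T q).trans ?_
    simp only [hT]

/-- A definable relation between the values of two terms of the second sort is definable from the
values of the types. -/
theorem exists_definable_algTerm_rel {m n : ℕ} (σ τ : AlgTerm m n)
    {Q : (symThreeReducedPower 𝓘).P → (symThreeReducedPower 𝓘).P → Prop}
    (hQ : ∀ {α : Type} (b c : α), FODefinable FirstOrder.Language.order
      (fun v : α → (symThreeReducedPower 𝓘).P => Q (v b) (v c))) :
    ∃ R : ((TupleType m ⊕ Fin n) → (symThreeReducedPower 𝓘).P) → Prop,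
      FODefinable FirstOrder.Language.order R ∧
      ∀ (a : Fin m → ι → Equiv.Perm (Fin 3)) (y : Fin n → (symThreeReducedPower 𝓘).P),
        Q (σ.eval (symThreeReducedPower 𝓘) (fun k => mainClass 𝓘 (a k)) y)
          (τ.eval (symThreeReducedPower 𝓘) (fun k => mainClass 𝓘 (a k)) y) ↔
        R (Sum.elim (typeValue 𝓘 a) y) := by
  obtain ⟨E, hE, hE'⟩ := exists_definable_algTerm (𝓘 := 𝓘) σ
  obtain ⟨F, hF, hF'⟩ := exists_definable_algTerm (𝓘 := 𝓘) τ
  -- `E` and `F` are graphs, with a unique value at actual type values, so universal quantification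
  -- merely substitutes it.
  refine ⟨fun v => ∀ p, E v p → ∀ q, F v q → Q p q,
    .forall_elem (hE.imp (.forall_elem ((hF.comp (Sum.map Sum.inl id)).imp
      (hQ (Sum.inl (Sum.inr ())) (Sum.inr ()))))), fun a y => ?_⟩
  simp only [hE', hF', forall_eq]

/-- The truth of a formula is a definable property of the values of the types. -/
theorem exists_definable_typeValue {m n : ℕ} (φ : StarFormula m n) :
    ∃ R : ((TupleType m ⊕ Fin n) → (symThreeReducedPower 𝓘).P) → Prop,
      FODefinable FirstOrder.Language.order R ∧
      ∀ (a : Fin m → ι → Equiv.Perm (Fin 3)) (y : Fin n → (symThreeReducedPower 𝓘).P),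
        φ.Realize (symThreeReducedPower 𝓘) (fun k => mainClass 𝓘 (a k)) y ↔
          R (Sum.elim (typeValue 𝓘 a) y) := by
  induction φ with
  | @eqMain m n s t =>
    obtain ⟨T, hT⟩ := exists_tupleType_pred (fun c => s.value c = t.value c) fun g c h => by
      rw [MainTerm.value_conj, MainTerm.value_conj, h]
    -- The equation holds in the reduced power exactly when the join of the types satisfying it is
    -- the top element.
    refine ⟨fun v => ∀ p, StarStructure.IsJoin _ (fun c => v (Sum.inl c)) T p →
      ∀ q, (symThreeReducedPower 𝓘).le q p,
      .forall_elem ((FODefinable.isJoin (fun c => Sum.inl (Sum.inl c)) T (Sum.inr ())).imp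
        (.forall_elem (FODefinable.le (Sum.inr ()) (Sum.inl (Sum.inr ()))))), fun a y => ?_⟩
    rw [StarFormula.Realize, MainTerm.eval_mainClass, MainTerm.eval_mainClass, mainClass_eq_iff]
    simp only [Sum.elim_inl, isJoin_typeValue, forall_eq, forall_le_algClass_iff, hT]
  | eqAlg s t => exact exists_definable_algTerm_rel s t fun b c => .eq (.var b) (.var c)
  | le s t => exact exists_definable_algTerm_rel s t fun b c => FODefinable.le b c
  | falsum => exact ⟨fun _ => False, .falsum, fun _ _ => Iff.rfl⟩
  | imp _ _ ih₁ ih₂ =>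
    obtain ⟨R₁, h₁, h₁'⟩ := ih₁
    obtain ⟨R₂, h₂, h₂'⟩ := ih₂
    exact ⟨fun v => R₁ v → R₂ v, h₁.imp h₂, fun a y => by rw [StarFormula.Realize, h₁', h₂']⟩
  | @allMain m n φ ih =>
    obtain ⟨R, hR, hR'⟩ := ih
    refine ⟨fun v => ∀ Z : TupleType (m + 1) → (symThreeReducedPower 𝓘).P,
      StarStructure.IsPartition _ Z →
      (∀ c, StarStructure.IsJoin _ Z (fun d => d.init = c) (v (Sum.inl c))) →
      R (Sum.elim Z (v ∘ Sum.inr)), ?_, fun a y => ?_⟩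
    · refine .forall_fun ((FODefinable.isPartition Sum.inr).imp ((FODefinable.forall_index
        fun c => FODefinable.isJoin Sum.inr _ (Sum.inl (Sum.inl c))).imp ?_))
      refine (hR.comp (Sum.elim Sum.inr fun j => Sum.inl (Sum.inr j))).congr fun w => ?_
      refine iff_of_eq (congrArg R ?_)
      ext1 (c | j) <;> rfl
    · change (∀ g, φ.Realize _ (Fin.snoc _ g) y) ↔ ∀ Z, StarStructure.IsPartition _ Z →
        (∀ c, StarStructure.IsJoin _ Z (fun d => d.init = c) (typeValue 𝓘 a c)) →
        R (Sum.elim Z y)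
      constructor
      · intro h Z hZ hZa
        obtain ⟨f, rfl⟩ := (isPartition_iff Z).1 hZ
        have hf : ∀ᶠ i in dualFilter 𝓘, (f i).init = tupleType fun k => a k i := by
          have : ∀ c, ∀ᶠ i in dualFilter 𝓘,
              (tupleType fun k => a k i) = c ↔ (f i).init = c := fun c =>
            algClass_eq_iff.1 ((isJoin_algClass_iff f _ _).1 (hZa c))
          filter_upwards [eventually_all.2 this] with i hi using (hi _).1 rfl
        -- Almost every `f i` extends the type of the given tuple at `i`, so an element with type
        -- values `Z` is assembled coordinate by coordinate.
        choose! g hg using fun (i : ι) (h : (f i).init = tupleType fun k => a k i) =>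
          exists_tupleType_snoc h
        have := h (mainClass 𝓘 g)
        rw [snoc_mainClass, hR'] at this
        convert this using 2
        refine funext fun c => algClass_eq_iff.2 ?_
        filter_upwards [hf] with i hi
        rw [snoc_apply, hg i hi]
      · intro h b
        obtain ⟨b, rfl⟩ := mainClass_surjective 𝓘 b
        rw [snoc_mainClass, hR']
        refine h _ ((isPartition_iff _).2 ⟨_, rfl⟩) fun c => (isJoin_typeValue _ _ _).2 ?_
        refine algClass_eq_iff.2 (.of_forall fun i => ?_)
        rw [snoc_apply, TupleType.init_tupleType, Fin.init_snoc]
  | @allAlg m n φ ih =>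
    obtain ⟨R, hR, hR'⟩ := ih
    refine ⟨fun v => ∀ p, R (Sum.elim (v ∘ Sum.inl)
      (Fin.snoc (α := fun _ => (symThreeReducedPower 𝓘).P) (v ∘ Sum.inr) p)), ?_, fun a y => ?_⟩
    · refine .forall_elem ((hR.comp (Sum.elim (fun c => Sum.inl (Sum.inl c))
        (Fin.snoc (α := fun _ => (TupleType m ⊕ Fin n) ⊕ Unit)
          (fun j => Sum.inl (Sum.inr j)) (Sum.inr ())))).congr fun w => ?_)
      refine iff_of_eq (congrArg R ?_)
      ext1 (c | j)
      · rfl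
      · refine Fin.lastCases ?_ (fun j => ?_) j <;> simp
    · rw [StarFormula.Realize]
      exact forall_congr' fun p => hR' a _

/-- Distinct types are separated by a term of the second sort. -/
theorem exists_separating_algTerm {m : ℕ} (n : ℕ) {p q : TupleType m} (h : p ≠ q) :
    ∃ (σ : AlgTerm m n) (T : TupleType m → Prop),
      (∀ (a : Fin m → ι → Equiv.Perm (Fin 3)) (y : Fin n → (symThreeReducedPower 𝓘).P),
        σ.eval (symThreeReducedPower 𝓘) (fun k => mainClass 𝓘 (a k)) y =
          algClass 𝓘 fun i => T (tupleType fun k => a k i)) ∧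
      ¬(T p ↔ T q) := by
  obtain ⟨c, rfl⟩ : ∃ c, tupleType c = p := Quotient.mk_surjective p
  obtain ⟨d, rfl⟩ : ∃ d, tupleType d = q := Quotient.mk_surjective q
  by_cases h₂ : ∀ t : MainTerm m, t.value c ^ 2 = 1 ↔ t.value d ^ 2 = 1
  · by_cases h₃ : ∀ t : MainTerm m, t.value c ^ 3 = 1 ↔ t.value d ^ 3 = 1
    · exact absurd (tupleType_eq_of_value_pow h₂ h₃) h
    · obtain ⟨t, ht⟩ := not_forall.1 h₃
      obtain ⟨T, hT⟩ := exists_tupleType_pow t 3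
      refine ⟨.supp₃ t, T, fun a y => ?_, by rwa [hT, hT]⟩
      rw [AlgTerm.eval, MainTerm.eval_mainClass, supp₃_mainClass]
      simp only [hT]
  · obtain ⟨t, ht⟩ := not_forall.1 h₂
    obtain ⟨T, hT⟩ := exists_tupleType_pow t 2
    refine ⟨.supp₂ t, T, fun a y => ?_, by rwa [hT, hT]⟩
    rw [AlgTerm.eval, MainTerm.eval_mainClass, supp₂_mainClass]
    simp only [hT]

theorem eliminatesQuantifiersRelAlg_symThreeReducedPower (𝓘 : Order.Ideal (Set ι)) :
    (symThreeReducedPower 𝓘).EliminatesQuantifiersRelAlg := by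
  intro m n φ
  obtain ⟨R, hR, hR'⟩ := exists_definable_typeValue (𝓘 := 𝓘) φ
  choose σ T hσ hT using fun w : {w : TupleType m × TupleType m // w.1 ≠ w.2} =>
    exists_separating_algTerm (𝓘 := 𝓘) n w.2
  have hdef : FODefinable FirstOrder.Language.order
      (fun v : {w : TupleType m × TupleType m // w.1 ≠ w.2} ⊕ Fin n →
          (symThreeReducedPower 𝓘).P =>
        -- The prescribed joins are the values of the separating terms; the only partition
        -- compatible with them is the family of type values.
        ∀ Z : TupleType m → (symThreeReducedPower 𝓘).P, StarStructure.IsPartition _ Z →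
          (∀ w, StarStructure.IsJoin _ Z (T w) (v (Sum.inl w))) →
          R (Sum.elim Z (v ∘ Sum.inr))) := by
    refine .forall_fun ((FODefinable.isPartition Sum.inr).imp ((FODefinable.forall_index
      fun w => FODefinable.isJoin Sum.inr _ (Sum.inl (Sum.inl w))).imp ?_))
    refine (hR.comp (Sum.elim Sum.inr fun j => Sum.inl (Sum.inr j))).congr fun w => ?_
    refine iff_of_eq (congrArg R ?_)
    ext1 (c | j) <;> rfl
  obtain ⟨ψ, hψ, hψ'⟩ := hdef.exists_isAlgFormula (Sum.elim σ fun j => AlgTerm.var j)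
  refine ⟨ψ, .alg hψ, fun x y => ?_⟩
  choose a ha using fun k => mainClass_surjective 𝓘 (x k)
  obtain rfl : (fun k => mainClass 𝓘 (a k)) = x := funext ha
  rw [hψ', hR']
  change _ ↔ ∀ Z, StarStructure.IsPartition _ Z → (∀ w, StarStructure.IsJoin _ Z (T w)
    ((σ w).eval (symThreeReducedPower 𝓘) (fun k => mainClass 𝓘 (a k)) y)) → R (Sum.elim Z y)
  constructor
  · intro h Z hZ hZσ
    obtain ⟨f, rfl⟩ := (isPartition_iff Z).1 hZ
    convert h using 2
    have hf : ∀ w, ∀ᶠ i in dualFilter 𝓘,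
        T w (tupleType fun k => a k i) ↔ T w (f i) := fun w => by
      have := (isJoin_algClass_iff f _ _).1 (hZσ w)
      rw [hσ] at this
      exact algClass_eq_iff.1 this
    refine funext fun c => algClass_eq_iff.2 ?_
    filter_upwards [eventually_all.2 hf] with i hi
    have : f i = tupleType fun k => a k i := by
      by_contra hne
      -- Two different types at coordinate `i` would be told apart by the term attached to that
      -- pair.
      exact hT ⟨(_, _), hne⟩ (hi ⟨(_, _), hne⟩).symm
    rw [this]
  · intro h
    exact h (typeValue 𝓘 a) ((isPartition_iff _).2 ⟨_, rfl⟩) fun w =>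
      (isJoin_typeValue _ _ _).2 (hσ w a y)

end QuantifierElimination

theorem proposition4p26 {ι : Type u} (𝓘 : Order.Ideal (Set ι)) (h𝓘 : 𝓘.IsProper) :
    (symThreeReducedPower 𝓘).IsInterpretableExpansion ∧
      (symThreeReducedPower 𝓘).EliminatesQuantifiersRelAlg := by
  exact ⟨isInterpretableExpansion_symThreeReducedPower 𝓘,
    eliminatesQuantifiersRelAlg_symThreeReducedPower 𝓘⟩
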